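/- Let $\mathbb D=\{z\in\mathbb C:|z|<1\}$ be equipped with the normalized Lebesgue measure $m$ ($m(\mathbb D)=1$). Let $\mathrm{Conf}(\mathbb D)$ be the space of non-negative integer-valued Radon measures $X$ on $\mathbb D$, with the $\sigma$-algebra generated by the maps $\#B(X)=X(B)$, $B\subset\mathbb D$ Borel (this is the Borel $\sigma$-algebra of the vague topology). A point process on $\mathbb D$ is a probability measure $\mathbb P$ on $\mathrm{Conf}(\mathbb D)$. Call a Borel set $B\subset \mathbb D$ bounded if it is relatively compact in $\mathbb D$. The process $\mathbb P$ is determinantal with kernel $K:\mathbb D\times\mathbb D\to\mathbb C$ if for all pairwise disjoint bounded Borel sets $B_1,\dots,B_k$ and all integers $n_1,\dots,n_k\ge1$ with sum $n$, $$\mathbb E_{\mathbb P}\Big[\prod_{i=1}^k\frac{(\#B_i)!}{(\#B_i-n_i)!}\Big]=\int_{B_1^{n_1}\times\cdots\times B_k^{n_k}}\det\big[K(x_i,x_j)\big]_{i,j=1}^n\,dm(x_1)\cdots dm(x_n),$$ both sides being finite (the quotient is read as $0$ when $\#B_i<n_i$). For a Borel set $C\subset\mathbb D$ let $\mathcal F_C$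 be the $\sigma$-algebra on $\mathrm{Conf}(\mathbb D)$ generated by the variables $\#B$ with $B\subset C$ Borel, and let $\mathcal F_C^{\mathbb P}$ be its completion with respect to $\mathbb P$, i.e. the $\sigma$-algebra of the sets that differ from a set of $\mathcal F_C$ by a $\mathbb P$-null set. The process $\mathbb P$ is number rigid if for every bounded Borel set $B\subset\mathbb D$ the random variable $\#B$ is $\mathcal F^{\mathbb P}_{\mathbb D\setminus B}$-measurable. **Theorem.** Let $\Lambda\subset\mathbb N=\{0,1,2,\dots\}$ be infinite, and suppose that $f_\Lambda(z)=\sum_{n\in\Lambda}z^n$ lies in the Bloch space, i.e. $f_\Lambda$ is holomorphic on $\mathbb D$ and $\sup_{z\in\mathbb D}(1-|z|)\,|f_\Lambda'(z)|<\infty$. Then the determinantal point process on $\mathbb D$ with the kernel $$K_\Lambda(z,w)=\sum_{n\in\Lambda}(n+1)z^n\bar w^n$$ is number rigid; that is, every probability measure $\mathbb P$ on $\mathrm{Conf}(\mathbb D)$ that is determinantal with kernel $K_\Lambda$ is number rigid. -/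

import Mathlib

open MeasureTheory Set
open scoped ENNReal ComplexConjugate

noncomputable section

namespace PointProcess

section General

variable {M : Type*} [TopologicalSpace M] [MeasurableSpace M]

/-- Borel sets that are bounded in the sense of the theory of point processes on a locally compact
space, i.e. relatively compact. -/
def IsBoundedBorel (B : Set M) : Prop :=
  MeasurableSet B ∧ IsCompact (closure B)

variable (M) in
/-- The space of configurations: the non-negative measures which take a (finite) integer value on
every relatively compact Borel set. On a locally compact second countable metrizable space these
are exactly the non-negative integer-valued Radon measures. -/
def Configuration : Type _ :=
  {X : Measure M // ∀ B : Set M, IsBoundedBorel B → ∃ k : ℕ, X B = k}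

namespace Configuration

/-- The number `#B (X) = X(B)` of points of the configuration `X` in `B`, counted with
multiplicity; possibly infinite if `B` is not relatively compact. -/
def number (B : Set M) (X : Configuration M) : ℝ≥0∞ := X.1 B

/-- The number of points in `B` as a natural number. -/
def count (B : Set M) (X : Configuration M) : ℕ := ⌊(X.number B).toReal⌋₊

theorem number_eq_count {B : Set M} (hB : IsBoundedBorel B) (X : Configuration M) :
    X.number B = (X.count B : ℝ≥0∞) := by
  obtain ⟨k, hk⟩ := X.2 B hB
  simp [count, number, hk]

/-- The `σ`-algebra `𝓕_C` generated by the random variables `#B`, with `B ⊆ C` Borel. -/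
@[reducible] def sigmaAlgebraOn (C : Set M) : MeasurableSpace (Configuration M) :=
  ⨆ (B : Set M) (_ : MeasurableSet B) (_ : B ⊆ C),
    MeasurableSpace.comap (number B) inferInstance

/-- The `σ`-algebra on the space of configurations, generated by all the variables `#B`. On a
locally compact second countable metrizable space it is the Borel `σ`-algebra of the vague
topology. -/
instance instMeasurableSpace : MeasurableSpace (Configuration M) := sigmaAlgebraOn univ

end Configuration

/-- The probability measure `P` on configurations is determinantal with kernel `K` with respect to
the reference measure `μ`: for pairwise disjoint bounded Borel sets `B₁, …, B_m` and integers
`n₁, …, n_m ≥ 1`, the mixed factorial moment `𝔼 ∏ (#B_i)! / (#B_i - n_i)!` is the integral of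
`det [K(x_p, x_q)]` over `B₁^{n₁} × ⋯ × B_m^{n_m}` (both integrals being finite). The points are
indexed by the pairs `⟨i, j⟩` with `i < m`, `j < n_i`. The quotient of factorials, read as `0` if
`#B_i < n_i`, is the falling factorial. -/
def IsDeterminantal (μ : Measure M) (K : M → M → ℂ) (P : Measure (Configuration M)) : Prop :=
  ∀ (m : ℕ) (B : Fin m → Set M) (n : Fin m → ℕ),
    (∀ i, IsBoundedBorel (B i)) → Pairwise (fun i j => Disjoint (B i) (B j)) → (∀ i, 1 ≤ n i) →
    let N : Configuration M → ℝ := fun X => ∏ i, ((X.count (B i)).descFactorial (n i) : ℝ)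
    let D : ((Σ i : Fin m, Fin (n i)) → M) → ℂ := fun x =>
      (Matrix.of fun p q => K (x p) (x q)).det
    let box : Set ((Σ i : Fin m, Fin (n i)) → M) := univ.pi fun p => B p.1
    Integrable N P ∧ IntegrableOn D box (Measure.pi fun _ => μ) ∧
      ((∫ X, N X ∂P : ℝ) : ℂ) = ∫ x in box, D x ∂(Measure.pi fun _ => μ)

/-- Number rigidity: for every bounded Borel set `B`, the variable `#B` is measurable with respect
to the `P`-completion of `𝓕_{M ∖ B}`, i.e. the `σ`-algebra of those events that agree, up to a
`P`-null set, with an event of `𝓕_{M ∖ B}`. -/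
def IsNumberRigid (P : Measure (Configuration M)) : Prop :=
  ∀ B : Set M, IsBoundedBorel B →
    Measurable[eventuallyMeasurableSpace (Configuration.sigmaAlgebraOn Bᶜ) (ae P)]
      (Configuration.number B)

end General

end PointProcess

namespace SubBergman

/-- The open unit disc, with its subspace topology and Borel `σ`-algebra. -/
abbrev Disc : Type := Metric.ball (0 : ℂ) 1

/-- The Lebesgue measure on the unit disc, normalized to have total mass `1`. -/
def discMeasure : Measure Disc :=
  (ENNReal.ofReal Real.pi)⁻¹ • Measure.comap (Subtype.val : Disc → ℂ) volume

/-- Membership in the Bloch space: `f` is holomorphic on the unit disc and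
`sup_{|z| < 1} (1 - |z|) |f'(z)| < ∞`. -/
def IsBloch (f : ℂ → ℂ) : Prop :=
  DifferentiableOn ℂ f (Metric.ball 0 1) ∧
    BddAbove ((fun z => (1 - ‖z‖) * ‖deriv f z‖) '' Metric.ball 0 1)

/-- The function `f_Λ(z) = ∑_{n ∈ Λ} z ^ n` (a convergent series for `|z| < 1`). -/
def lambdaSeries (Λ : Set ℕ) (z : ℂ) : ℂ := ∑' n : Λ, z ^ (n : ℕ)

/-- The sub-Bergman kernel `K_Λ(z, w) = ∑_{n ∈ Λ} (n + 1) z ^ n (conj w) ^ n` on the disc. -/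
def subBergmanKernel (Λ : Set ℕ) (z w : Disc) : ℂ :=
  ∑' n : Λ, ((n : ℕ) + 1 : ℂ) * (z : ℂ) ^ (n : ℕ) * conj (w : ℂ) ^ (n : ℕ)

end SubBergman

end

/-!
The kernel `K_Λ` is that of the orthogonal projection onto the span of the monomials `z ^ n`,
`n ∈ Λ`, which are orthogonal on every disc centred at `0`. Hence, for the concentric discs of
squared radii `s ≤ t < 1`, the covariance of the numbers of points is
`∑_{n ∈ Λ} s ^ (n + 1) (1 - t ^ (n + 1))`. By Bernoulli's inequality this is at most
`(1 - t) ∑_{n ∈ Λ} (n + 1) s ^ (n + 1)`, and since `f_Λ` has non-negative coefficients, the Bloch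
condition at the point `s` bounds it by `C (1 - t) / (1 - s)` (`SubBergman.disc_covariance_le`).

For the discs `D_j` of squared radius `1 - 2 ^ (-j - j₀)` the covariances therefore decay like
`2 ^ (-|j - k|)`, so that the average `(1 / L) ∑_{j < L} #D_j` has variance `O(1 / L)`. If `j₀` is
so large that `B ⊆ D_j` for all `j`, this average is `#B` plus a variable that depends only on the
configuration outside `B`. As the centred averages tend to `0` almost surely along a subsequence,
the points outside `B` determine `#B` (`PointProcess.isNumberRigid_of_covariance_le`).
-/

/-! ### Means and covariances of a determinantal point process -/

namespace PointProcess

variable {M : Type*} [TopologicalSpace M] [MeasurableSpace M]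

theorem IsBoundedBorel.mono {A B : Set M} (hB : IsBoundedBorel B) (hA : MeasurableSet A)
    (h : A ⊆ B) : IsBoundedBorel A :=
  ⟨hA, hB.2.of_isClosed_subset isClosed_closure (closure_mono h)⟩

namespace Configuration

theorem count_add_count_diff {A B : Set M} (hA : IsBoundedBorel A) (hB : IsBoundedBorel B)
    (h : A ⊆ B) (X : Configuration M) : X.count B = X.count A + X.count (B \ A) := by
  have hBA : IsBoundedBorel (B \ A) := hB.mono (hB.1.diff hA.1) sdiff_subset
  have key : X.number B = X.number A + X.number (B \ A) := by
    have := measure_union (μ := X.1) (disjoint_sdiff_right (s := A) (t := B)) hBA.1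
    rwa [union_sdiff_cancel h] at this
  rw [number_eq_count hA, number_eq_count hB, number_eq_count hBA] at key
  exact_mod_cast key

theorem measurable_number {B C : Set M} (hB : MeasurableSet B) (h : B ⊆ C) :
    Measurable[sigmaAlgebraOn C] (number B) := by
  rw [measurable_iff_comap_le]
  exact le_iSup_of_le B (le_iSup_of_le hB (le_iSup_of_le h le_rfl))

theorem measurable_count {B C : Set M} (hB : MeasurableSet B) (h : B ⊆ C) :
    Measurable[sigmaAlgebraOn C] fun X => (count B X : ℝ) := by
  have h1 : Measurable fun x : ℝ≥0∞ => ((⌊x.toReal⌋₊ : ℕ) : ℝ) :=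
    measurable_from_nat.comp (Nat.measurable_floor.comp ENNReal.measurable_toReal)
  exact h1.comp (measurable_number hB h)

end Configuration

/-- Integrals over pairs of points indexed by a two-element type, as integrals over a product. -/
theorem integral_det_two {α : Type*} [MeasurableSpace α] {μ : Measure α} [SigmaFinite μ]
    (K : α → α → ℂ) {ι : Type*} [Fintype ι] [DecidableEq ι] (e : Fin 2 ≃ ι) (B : ι → Set α)
    (h : IntegrableOn (fun x : ι → α => (Matrix.of fun p q => K (x p) (x q)).det) (univ.pi B)
      (Measure.pi fun _ => μ)) :
    IntegrableOn (fun z : α × α => K z.1 z.1 * K z.2 z.2 - K z.1 z.2 * K z.2 z.1)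
        (B (e 0) ×ˢ B (e 1)) (μ.prod μ) ∧
      ∫ x in univ.pi B, (Matrix.of fun p q => K (x p) (x q)).det ∂(Measure.pi fun _ => μ) =
        ∫ z in B (e 0) ×ˢ B (e 1), (K z.1 z.1 * K z.2 z.2 - K z.1 z.2 * K z.2 z.1)
          ∂(μ.prod μ) := by
  let φ : (ι → α) ≃ᵐ α × α :=
    (MeasurableEquiv.piCongrLeft (fun _ : ι => α) e).symm.trans MeasurableEquiv.finTwoArrow
  have hφ : MeasurePreserving φ (Measure.pi fun _ => μ) (μ.prod μ) :=
    (measurePreserving_finTwoArrow μ).comp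
      ((measurePreserving_piCongrLeft (fun _ : ι => μ) e).symm _)
  have hφx : ∀ x, φ x = (x (e 0), x (e 1)) := fun x => rfl
  have hdet : (fun x : ι → α => (Matrix.of fun p q => K (x p) (x q)).det) =
      (fun z : α × α => K z.1 z.1 * K z.2 z.2 - K z.1 z.2 * K z.2 z.1) ∘ φ := by
    funext x
    rw [← Matrix.det_submatrix_equiv_self e, Matrix.det_fin_two]
    simp [hφx]
  have hbox : univ.pi B = φ ⁻¹' (B (e 0) ×ˢ B (e 1)) := by
    ext x
    rw [mem_univ_pi, ← e.forall_congr_right (q := fun i => x i ∈ B i), Fin.forall_fin_two]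
    rfl
  rw [hdet, hbox] at h
  refine ⟨(hφ.integrableOn_comp_preimage φ.measurableEmbedding).1 h, ?_⟩
  rw [hdet, hbox]
  exact hφ.setIntegral_preimage_emb φ.measurableEmbedding
    (fun z : α × α => K z.1 z.1 * K z.2 z.2 - K z.1 z.2 * K z.2 z.1) _

namespace IsDeterminantal

variable {μ : Measure M} {K : M → M → ℂ} {P : Measure (Configuration M)}

theorem mean [SigmaFinite μ] (hP : IsDeterminantal μ K P) {A : Set M} (hA : IsBoundedBorel A) :
    Integrable (fun X => (X.count A : ℝ)) P ∧ IntegrableOn (fun x => K x x) A μ ∧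
      ((∫ X, (X.count A : ℝ) ∂P : ℝ) : ℂ) = ∫ x in A, K x x ∂μ := by
  obtain ⟨h1, h2, h3⟩ := hP 1 (fun _ => A) (fun _ => 1) (fun _ => hA)
    (fun i j h => (h (Subsingleton.elim i j)).elim) (fun _ => le_rfl)
  simp only [Finset.univ_unique, Finset.prod_singleton, Nat.descFactorial_one] at h1 h3
  let _ : Unique (Σ _ : Fin 1, Fin 1) := ⟨⟨⟨0, 0⟩⟩, by decide⟩
  have hφ := measurePreserving_funUnique μ (Σ _ : Fin 1, Fin 1)
  let φ := MeasurableEquiv.funUnique (Σ _ : Fin 1, Fin 1) M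
  have hφx : ∀ x, φ x = x default := fun x => rfl
  have hbox : (univ.pi fun _ => A) = φ ⁻¹' A := by
    ext x
    simp [hφx, Unique.forall_iff]
  have hdet : (fun x : (Σ _ : Fin 1, Fin 1) → M =>
      (Matrix.of fun p q => K (x p) (x q)).det) = (fun x => K x x) ∘ φ := by
    funext x
    simp [Matrix.det_unique, hφx]
  rw [hdet, hbox] at h2 h3
  exact ⟨h1, (hφ.integrableOn_comp_preimage φ.measurableEmbedding).1 h2,
    h3.trans (hφ.setIntegral_preimage_emb φ.measurableEmbedding (fun x => K x x) _)⟩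

theorem factorial_moment_two [SigmaFinite μ] (hP : IsDeterminantal μ K P) {A : Set M}
    (hA : IsBoundedBorel A) :
    Integrable (fun X => ((X.count A).descFactorial 2 : ℝ)) P ∧
      IntegrableOn (fun z : M × M => K z.1 z.1 * K z.2 z.2 - K z.1 z.2 * K z.2 z.1)
        (A ×ˢ A) (μ.prod μ) ∧
      ((∫ X, ((X.count A).descFactorial 2 : ℝ) ∂P : ℝ) : ℂ) =
        ∫ z in A ×ˢ A, (K z.1 z.1 * K z.2 z.2 - K z.1 z.2 * K z.2 z.1) ∂(μ.prod μ) := by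
  obtain ⟨h1, h2, h3⟩ := hP 1 (fun _ => A) (fun _ => 2) (fun _ => hA)
    (fun i j h => (h (Subsingleton.elim i j)).elim) (fun _ => by norm_num)
  simp only [Finset.univ_unique, Finset.prod_singleton] at h1 h3
  obtain ⟨h4, h5⟩ := integral_det_two K
    (Equiv.ofBijective ![(⟨0, 0⟩ : Σ _ : Fin 1, Fin 2), ⟨0, 1⟩] (by decide)) (fun _ => A) h2
  exact ⟨h1, h4, h3.trans h5⟩

theorem mixed_moment [SigmaFinite μ] (hP : IsDeterminantal μ K P) {A B : Set M}
    (hA : IsBoundedBorel A) (hB : IsBoundedBorel B) (hAB : Disjoint A B) :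
    Integrable (fun X => (X.count A : ℝ) * X.count B) P ∧
      IntegrableOn (fun z : M × M => K z.1 z.1 * K z.2 z.2 - K z.1 z.2 * K z.2 z.1)
        (A ×ˢ B) (μ.prod μ) ∧
      ((∫ X, (X.count A : ℝ) * X.count B ∂P : ℝ) : ℂ) =
        ∫ z in A ×ˢ B, (K z.1 z.1 * K z.2 z.2 - K z.1 z.2 * K z.2 z.1) ∂(μ.prod μ) := by
  obtain ⟨h1, h2, h3⟩ := hP 2 ![A, B] (fun _ => 1) (by simp [Fin.forall_fin_two, hA, hB])
    (by
      intro i j hij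
      fin_cases i <;> fin_cases j <;> simp_all [hAB.symm])
    (fun _ => le_rfl)
  simp only [Fin.prod_univ_two, Nat.descFactorial_one] at h1 h3
  obtain ⟨h4, h5⟩ := integral_det_two K
    (Equiv.ofBijective ![(⟨0, 0⟩ : Σ _ : Fin 2, Fin 1), ⟨1, 0⟩] (by decide))
    (fun p => ![A, B] p.1) h2
  exact ⟨h1, h4, h3.trans h5⟩

/-- The mixed second moment for nested sets: the diagonal contributes the mean of the number of
points in the smaller set. -/
theorem nested_moment [SigmaFinite μ] (hP : IsDeterminantal μ K P) {A B : Set M}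
    (hA : IsBoundedBorel A) (hB : IsBoundedBorel B) (hAB : A ⊆ B) :
    Integrable (fun X => (X.count A : ℝ) * X.count B) P ∧
      IntegrableOn (fun z : M × M => K z.1 z.1 * K z.2 z.2 - K z.1 z.2 * K z.2 z.1)
        (A ×ˢ B) (μ.prod μ) ∧
      ((∫ X, (X.count A : ℝ) * X.count B ∂P : ℝ) : ℂ) = (∫ x in A, K x x ∂μ) +
        ∫ z in A ×ˢ B, (K z.1 z.1 * K z.2 z.2 - K z.1 z.2 * K z.2 z.1) ∂(μ.prod μ) := by
  have hBA : IsBoundedBorel (B \ A) := hB.mono (hB.1.diff hA.1) sdiff_subset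
  obtain ⟨i1, -, e1⟩ := hP.mean hA
  obtain ⟨i2, j2, e2⟩ := hP.factorial_moment_two hA
  obtain ⟨i3, j3, e3⟩ := hP.mixed_moment hA hBA disjoint_sdiff_right
  have key : (fun X : Configuration M => (X.count A : ℝ) * X.count B) = fun X =>
      (X.count A : ℝ) + (X.count A).descFactorial 2 + X.count A * X.count (B \ A) := by
    funext X
    rw [Configuration.count_add_count_diff hA hB hAB]
    have : X.count A * X.count A = X.count A + (X.count A).descFactorial 2 := by
      cases X.count A <;> simp [Nat.descFactorial]
      ring
    have : (X.count A : ℝ) * X.count A = X.count A + (X.count A).descFactorial 2 := by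
      exact_mod_cast this
    push_cast
    linear_combination this
  have hu : A ×ˢ B = A ×ˢ A ∪ A ×ˢ (B \ A) := by
    rw [← prod_union, union_sdiff_cancel hAB]
  have hd : Disjoint (A ×ˢ A) (A ×ˢ (B \ A)) := Disjoint.set_prod_right disjoint_sdiff_right _ _
  rw [key, hu]
  refine ⟨(i1.add i2).add i3, j2.union j3, ?_⟩
  have e4 := integral_add (i1.add i2) i3
  simp only [Pi.add_apply] at e4
  rw [e4, integral_add i1 i2, setIntegral_union hd (hA.1.prod hBA.1) j2 j3, ← e2, ← e3, ← e1]
  push_cast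
  ring

/-- The covariance of the numbers of points in nested sets. -/
theorem nested_covariance [SigmaFinite μ] [IsProbabilityMeasure P] (hP : IsDeterminantal μ K P)
    {A B : Set M} (hA : IsBoundedBorel A) (hB : IsBoundedBorel B) (hAB : A ⊆ B) :
    Integrable (fun X => ((X.count A : ℝ) - ∫ Y, (Y.count A : ℝ) ∂P) *
        (X.count B - ∫ Y, (Y.count B : ℝ) ∂P)) P ∧
      ((∫ X, ((X.count A : ℝ) - ∫ Y, (Y.count A : ℝ) ∂P) *
        (X.count B - ∫ Y, (Y.count B : ℝ) ∂P) ∂P : ℝ) : ℂ) =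
        (∫ x in A, K x x ∂μ) - ∫ z in A ×ˢ B, K z.1 z.2 * K z.2 z.1 ∂(μ.prod μ) := by
  obtain ⟨iA, jA, eA⟩ := hP.mean hA
  obtain ⟨iB, jB, eB⟩ := hP.mean hB
  obtain ⟨iAB, jAB, eAB⟩ := hP.nested_moment hA hB hAB
  set a := ∫ Y, (Y.count A : ℝ) ∂P
  set b := ∫ Y, (Y.count B : ℝ) ∂P
  have e : (fun X : Configuration M => ((X.count A : ℝ) - a) * (X.count B - b)) = fun X =>
      (X.count A : ℝ) * X.count B - (b * X.count A + a * X.count B - a * b) := by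
    funext X
    ring
  have i1 := (iA.const_mul b).add (iB.const_mul a)
  have i2 := i1.sub (integrable_const (a * b))
  have j1 : IntegrableOn (fun z : M × M => K z.1 z.1 * K z.2 z.2) (A ×ˢ B) (μ.prod μ) := by
    rw [IntegrableOn, ← Measure.prod_restrict]
    exact jA.mul_prod jB
  have j2 : IntegrableOn (fun z : M × M => K z.1 z.2 * K z.2 z.1) (A ×ˢ B) (μ.prod μ) := by
    refine (j1.sub jAB).congr (Filter.Eventually.of_forall fun z => ?_)
    simp only [Pi.sub_apply, sub_sub_cancel]
  rw [e]
  refine ⟨iAB.sub i2, ?_⟩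
  have e1 := integral_sub iAB i2
  have e2 := integral_sub i1 (integrable_const (μ := P) (a * b))
  have e3 := integral_add (iA.const_mul b) (iB.const_mul a)
  simp only [Pi.add_apply, Pi.sub_apply] at e1 e2 e3
  have e4 := integral_sub j1 j2
  rw [setIntegral_prod_mul (fun x => K x x) (fun x => K x x), ← eA, ← eB] at e4
  rw [e1, e2, e3, integral_const_mul, integral_const_mul, Complex.ofReal_sub, eAB, e4, ← eA]
  simp only [integral_const, probReal_univ, one_smul]
  push_cast
  ring

end IsDeterminantal

/-! ### Rigidity from averages of small variance -/

/-- If covariances decay geometrically, the variance of a sum grows at most linearly. -/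
theorem integral_sum_sq_le {Ω : Type*} [MeasurableSpace Ω] {P : Measure Ω} {Y : ℕ → Ω → ℝ}
    {C : ℝ} (hC : 0 ≤ C) (hi : ∀ j k, Integrable (fun ω => Y j ω * Y k ω) P)
    (hcov : ∀ j k, j ≤ k → ∫ ω, Y j ω * Y k ω ∂P ≤ C * (1 / 2) ^ (k - j)) (L : ℕ) :
    Integrable (fun ω => (∑ j ∈ Finset.range L, Y j ω) ^ 2) P ∧
      ∫ ω, (∑ j ∈ Finset.range L, Y j ω) ^ 2 ∂P ≤ 5 * C * L := by
  induction L with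
  | zero => simp
  | succ L ih =>
    obtain ⟨i0, h0⟩ := ih
    have i1 : Integrable (fun ω => ∑ j ∈ Finset.range L, Y j ω * Y L ω) P :=
      integrable_finsetSum _ fun j _ => hi j L
    have e : (fun ω => (∑ j ∈ Finset.range (L + 1), Y j ω) ^ 2) = fun ω =>
        (∑ j ∈ Finset.range L, Y j ω) ^ 2 + 2 * (∑ j ∈ Finset.range L, Y j ω * Y L ω) +
          Y L ω * Y L ω := by
      funext ω
      rw [Finset.sum_range_succ, ← Finset.sum_mul]
      ring
    rw [e]
    refine ⟨(i0.add (i1.const_mul 2)).add (hi L L), ?_⟩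
    have e1 := integral_add (i0.add (i1.const_mul 2)) (hi L L)
    simp only [Pi.add_apply] at e1
    rw [e1, integral_add i0 (i1.const_mul 2),
      integral_const_mul, integral_finsetSum _ fun j _ => hi j L]
    have h1 : ∑ j ∈ Finset.range L, ∫ ω, Y j ω * Y L ω ∂P ≤ 2 * C := by
      calc ∑ j ∈ Finset.range L, ∫ ω, Y j ω * Y L ω ∂P
          ≤ ∑ j ∈ Finset.range L, C * (1 / 2) ^ (L - 1 - j) :=
            Finset.sum_le_sum fun j hj => by
              have hj : j < L := Finset.mem_range.1 hj
              refine (hcov j L hj.le).trans (mul_le_mul_of_nonneg_left ?_ hC)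
              exact pow_le_pow_of_le_one (by norm_num) (by norm_num) (by omega)
        _ = C * ∑ j ∈ Finset.range L, (1 / 2 : ℝ) ^ j := by
            rw [← Finset.mul_sum, Finset.sum_range_reflect (fun j => (1 / 2 : ℝ) ^ j) L]
        _ ≤ C * 2 := mul_le_mul_of_nonneg_left (sum_geometric_two_le L) hC
        _ = 2 * C := mul_comm _ _
    have h2 := hcov L L le_rfl
    simp only [Nat.sub_self, pow_zero, mul_one] at h2
    push_cast
    linarith

/-- A criterion for number rigidity: every bounded set `B` lies in all members of a sequence of
bounded sets whose centred counts have geometrically decaying covariances. The averages of these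
centred counts tend to `0`, and up to a constant they differ from `#B` by a variable that depends
on the configuration outside `B` only. -/
theorem isNumberRigid_of_covariance_le {P : Measure (Configuration M)}
    (h : ∀ B : Set M, IsBoundedBorel B → ∃ (D : ℕ → Set M) (c : ℕ → ℝ) (C : ℝ), 0 ≤ C ∧
      (∀ j, IsBoundedBorel (D j) ∧ B ⊆ D j) ∧
      (∀ j k, Integrable (fun X => ((X.count (D j) : ℝ) - c j) * (X.count (D k) - c k)) P) ∧
      (∀ j k, j ≤ k → ∫ X, ((X.count (D j) : ℝ) - c j) * (X.count (D k) - c k) ∂P ≤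
        C * (1 / 2) ^ (k - j))) :
    IsNumberRigid P := by
  intro B hB
  obtain ⟨D, c, C, hC, hD, hi, hcov⟩ := h B hB
  let Y : ℕ → Configuration M → ℝ := fun j X => (X.count (D j) : ℝ) - c j
  let Z : ℕ → Configuration M → ℝ := fun L X => ((L : ℝ)⁻¹ * ∑ j ∈ Finset.range L, Y j X) ^ 2
  have hZ : ∀ L, Integrable (Z L) P ∧ ∫ X, Z L X ∂P ≤ 5 * C * (L : ℝ)⁻¹ := by
    intro L
    obtain ⟨h1, h2⟩ := integral_sum_sq_le (Y := Y) hC hi hcov L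
    have e : Z L = fun X => ((L : ℝ)⁻¹) ^ 2 * (∑ j ∈ Finset.range L, Y j X) ^ 2 := by
      funext X
      exact mul_pow _ _ _
    rw [e]
    refine ⟨h1.const_mul _, ?_⟩
    rw [integral_const_mul]
    refine (mul_le_mul_of_nonneg_left h2 (sq_nonneg _)).trans (le_of_eq ?_)
    rcases eq_or_ne (L : ℝ) 0 with h0 | h0
    · simp [h0]
    · field_simp
  have hlim : Filter.Tendsto (fun L => eLpNorm (Z L - 0) 1 P) Filter.atTop (nhds 0) := by
    have e : ∀ L, eLpNorm (Z L - 0) 1 P = ENNReal.ofReal (∫ X, Z L X ∂P) := by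
      intro L
      rw [sub_zero, eLpNorm_one_eq_lintegral_enorm, ← ofReal_integral_norm_eq_lintegral_enorm (hZ L).1]
      simp only [Z, norm_pow, Real.norm_eq_abs, sq_abs]
    simp only [e]
    rw [← ENNReal.ofReal_zero]
    refine ENNReal.tendsto_ofReal ?_
    refine squeeze_zero (fun L => integral_nonneg fun X => sq_nonneg _) (fun L => (hZ L).2) ?_
    simpa using (tendsto_natCast_atTop_atTop (R := ℝ)).inv_tendsto_atTop.const_mul (5 * C)
  obtain ⟨ns, hns, hae⟩ := (tendstoInMeasure_of_tendsto_eLpNorm one_ne_zero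
    (fun L => (hZ L).1.aestronglyMeasurable) aestronglyMeasurable_zero hlim).exists_seq_tendsto_ae
  let W : ℕ → Configuration M → ℝ := fun L X =>
    (L : ℝ)⁻¹ * ∑ j ∈ Finset.range L, (c j - (X.count (D j \ B) : ℝ))
  have hW : ∀ L, Measurable[Configuration.sigmaAlgebraOn Bᶜ] (W L) := by
    intro L
    refine Measurable.const_mul (Finset.measurable_fun_sum _ fun j _ => ?_) _
    exact measurable_const.sub
      (Configuration.measurable_count ((hD j).1.1.diff hB.1) fun x hx => hx.2)
  have hWlim : Measurable[Configuration.sigmaAlgebraOn Bᶜ]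
      fun X => Filter.limsup (fun i => ENNReal.ofReal (W (ns i) X)) Filter.atTop :=
    Measurable.limsup fun i => (hW (ns i)).ennreal_ofReal
  refine hWlim.eventuallyMeasurable_of_eventuallyEq ?_
  filter_upwards [hae] with X hX
  have hsqrt : Filter.Tendsto (fun i => ((ns i : ℕ) : ℝ)⁻¹ * ∑ j ∈ Finset.range (ns i), Y j X)
      Filter.atTop (nhds 0) := by
    have h1 := hX.sqrt
    simp only [Z, Real.sqrt_sq_eq_abs, Pi.zero_apply, Real.sqrt_zero] at h1
    exact (tendsto_zero_iff_abs_tendsto_zero _).2 h1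
  have hWX : Filter.Tendsto (fun i => W (ns i) X) Filter.atTop (nhds (X.count B : ℝ)) := by
    have h1 : Filter.Tendsto (fun i => (X.count B : ℝ) -
        ((ns i : ℕ) : ℝ)⁻¹ * ∑ j ∈ Finset.range (ns i), Y j X) Filter.atTop
        (nhds (X.count B : ℝ)) := by
      simpa using hsqrt.const_sub (X.count B : ℝ)
    refine h1.congr' ?_
    filter_upwards [hns.tendsto_atTop.eventually_gt_atTop 0] with i hpos
    have h0 : ((ns i : ℕ) : ℝ) ≠ 0 := by exact_mod_cast hpos.ne'
    have h2 : ∀ j, Y j X = X.count B - (c j - (X.count (D j \ B) : ℝ)) := by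
      intro j
      simp only [Y]
      rw [Configuration.count_add_count_diff hB (hD j).1 (hD j).2]
      push_cast
      ring
    simp only [W, h2, Finset.sum_sub_distrib, Finset.sum_const, Finset.card_range, nsmul_eq_mul]
    field_simp
    ring
  rw [Configuration.number_eq_count hB, ← ENNReal.ofReal_natCast]
  exact (ENNReal.tendsto_ofReal hWX).limsup_eq.symm

end PointProcess

/-! ### Moments of monomials on discs -/

namespace SubBergman

instance : IsFiniteMeasure discMeasure := by
  refine ⟨?_⟩
  rw [discMeasure, Measure.smul_apply, comap_subtype_coe_apply measurableSet_ball, image_univ,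
    Subtype.range_coe, smul_eq_mul]
  exact ENNReal.mul_lt_top (by simp [Real.pi_pos]) measure_ball_lt_top

/-- The concentric disc of radius `√t`. In terms of the squared radius `t`, the normalized measure
of the disc is `t`, and its `2n`-th moment is `t ^ (n + 1) / (n + 1)`. -/
def disc (t : ℝ) : Set Disc := {z | ‖(z : ℂ)‖ ^ 2 < t}

theorem measurableSet_disc (t : ℝ) : MeasurableSet (disc t) :=
  measurableSet_lt (by fun_prop) measurable_const

theorem disc_subset_disc {s t : ℝ} (h : s ≤ t) : disc s ⊆ disc t := fun _ hz => lt_of_lt_of_le hz h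

theorem isBoundedBorel_disc {t : ℝ} (ht : t < 1) : PointProcess.IsBoundedBorel (disc t) := by
  refine ⟨measurableSet_disc t, ?_⟩
  have hK : IsCompact {z : Disc | ‖(z : ℂ)‖ ^ 2 ≤ t} := by
    rw [Subtype.isCompact_iff]
    have : Subtype.val '' {z : Disc | ‖(z : ℂ)‖ ^ 2 ≤ t} = {z : ℂ | ‖z‖ ^ 2 ≤ t} := by
      ext z
      simp only [mem_image, mem_ofPred_eq, Subtype.exists, mem_ball_zero_iff]
      refine ⟨?_, fun h => ⟨z, ?_, h, rfl⟩⟩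
      · rintro ⟨w, hw, h, rfl⟩
        exact h
      · nlinarith [norm_nonneg z]
    rw [this]
    refine Metric.isCompact_of_isClosed_isBounded (isClosed_le (by fun_prop) continuous_const) ?_
    refine (Metric.isBounded_ball (x := (0 : ℂ)) (r := 1)).subset fun z hz => ?_
    rw [mem_ball_zero_iff]
    have : ‖z‖ ^ 2 ≤ t := hz
    nlinarith [norm_nonneg z]
  refine hK.of_isClosed_subset isClosed_closure (closure_minimal ?_ ?_)
  · intro z hz
    have hz : ‖(z : ℂ)‖ ^ 2 < t := hz
    exact hz.le
  · exact isClosed_le (by fun_prop) continuous_const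

theorem exists_subset_disc {B : Set Disc} (hB : PointProcess.IsBoundedBorel B) :
    ∃ t < 1, B ⊆ disc t := by
  rcases B.eq_empty_or_nonempty with rfl | hne
  · exact ⟨0, zero_lt_one, empty_subset _⟩
  obtain ⟨w, -, hw⟩ := hB.2.exists_isMaxOn hne.closure
    (f := fun z : Disc => ‖(z : ℂ)‖ ^ 2) (by fun_prop)
  have hw1 : ‖(w : ℂ)‖ ^ 2 < 1 := by
    have := mem_ball_zero_iff.1 w.2
    nlinarith [norm_nonneg (w : ℂ)]
  obtain ⟨t, h1, h2⟩ := exists_between hw1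
  exact ⟨t, h2, fun z hz => lt_of_le_of_lt (hw (subset_closure hz)) h1⟩

theorem setIntegral_disc {t : ℝ} (ht : t ≤ 1) (g : ℂ → ℂ) :
    ∫ z in disc t, g z ∂discMeasure = (Real.pi : ℂ)⁻¹ * ∫ z in {z : ℂ | ‖z‖ ^ 2 < t}, g z := by
  have hS : MeasurableSet {z : ℂ | ‖z‖ ^ 2 < t} :=
    measurableSet_lt (by fun_prop) measurable_const
  have hsub : Metric.ball (0 : ℂ) 1 ∩ {z : ℂ | ‖z‖ ^ 2 < t} = {z : ℂ | ‖z‖ ^ 2 < t} := by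
    refine inter_eq_right.2 fun z hz => ?_
    have : ‖z‖ ^ 2 < t := hz
    rw [mem_ball_zero_iff]
    nlinarith [norm_nonneg z]
  rw [← integral_indicator (measurableSet_disc t), discMeasure, integral_smul_measure]
  have : (disc t).indicator (fun z : Disc => g z) =
      fun z : Disc => ({z : ℂ | ‖z‖ ^ 2 < t}.indicator g) z := by
    funext z
    by_cases hz : ‖(z : ℂ)‖ ^ 2 < t <;> simp [indicator, disc, hz]
  rw [this, integral_subtype_comap measurableSet_ball, setIntegral_indicator hS, hsub,
    ENNReal.toReal_inv, ENNReal.toReal_ofReal Real.pi_pos.le, Complex.real_smul]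
  push_cast
  rfl

/-- Distinct monomials are orthogonal on a disc: a rotation by `π / (n - m)` changes the sign of
the integral. -/
theorem setIntegral_pow_mul_conj_pow_of_ne {n m : ℕ} (h : n ≠ m) (t : ℝ) :
    ∫ z in {z : ℂ | ‖z‖ ^ 2 < t}, z ^ n * conj z ^ m = 0 := by
  let c : Circle := Circle.exp (Real.pi / ((n : ℝ) - m))
  have hnm : (n : ℂ) - m ≠ 0 := sub_ne_zero.2 (by exact_mod_cast h)
  have hc : (c : ℂ) ^ n * conj (c : ℂ) ^ m = -1 := by
    rw [← Complex.exp_pi_mul_I, ← Circle.coe_inv_eq_conj]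
    simp only [c, Circle.coe_inv, Circle.coe_exp]
    rw [← Complex.exp_neg, ← Complex.exp_nat_mul, ← Complex.exp_nat_mul, ← Complex.exp_add]
    congr 1
    push_cast
    field_simp
    ring
  have hφ : MeasurePreserving (rotation c) := (rotation c).measurePreserving
  have e := hφ.setIntegral_preimage_emb (rotation c).toHomeomorph.measurableEmbedding
    (fun z => z ^ n * conj z ^ m) {z : ℂ | ‖z‖ ^ 2 < t}
  have hpre : rotation c ⁻¹' {z : ℂ | ‖z‖ ^ 2 < t} = {z : ℂ | ‖z‖ ^ 2 < t} := by
    ext z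
    simp only [mem_preimage, mem_ofPred_eq, LinearIsometryEquiv.norm_map]
  have hF : ∀ z : ℂ, (rotation c z) ^ n * conj (rotation c z) ^ m = -(z ^ n * conj z ^ m) := by
    intro z
    rw [rotation_apply, map_mul, mul_pow, mul_pow]
    linear_combination (z ^ n * conj z ^ m) * hc
  simp only [hpre, hF, integral_neg] at e
  exact CharZero.eq_neg_self_iff.1 e.symm

theorem setIntegral_pow_mul_conj_pow_self (n : ℕ) {t : ℝ} (ht : 0 ≤ t) :
    ∫ z in {z : ℂ | ‖z‖ ^ 2 < t}, z ^ n * conj z ^ n = Real.pi * (t ^ (n + 1) / (n + 1)) := by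
  have hS : MeasurableSet {z : ℂ | ‖z‖ ^ 2 < t} :=
    measurableSet_lt (by fun_prop) measurable_const
  have e1 : {z : ℂ | ‖z‖ ^ 2 < t}.indicator (fun z => z ^ n * conj z ^ n) =
      fun z => (((Iio (√t)).indicator (fun y : ℝ => y ^ (2 * n)) ‖z‖ : ℝ) : ℂ) := by
    funext z
    have h1 : ‖z‖ ^ 2 < t ↔ ‖z‖ < √t := (Real.lt_sqrt (norm_nonneg z)).symm
    simp only [indicator, mem_ofPred_eq, mem_Iio, h1]
    split_ifs
    · rw [← mul_pow, Complex.mul_conj', pow_mul]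
      push_cast
      rfl
    · simp
  rw [← integral_indicator hS, e1, integral_complex_ofReal,
    integral_fun_norm_addHaar volume ((Iio (√t)).indicator fun y : ℝ => y ^ (2 * n))]
  have e2 : ∫ y in Ioi (0 : ℝ), y ^ (Module.finrank ℝ ℂ - 1) •
      (Iio (√t)).indicator (fun y : ℝ => y ^ (2 * n)) y = t ^ (n + 1) / (2 * (n + 1)) := by
    have : (fun y : ℝ => y ^ (Module.finrank ℝ ℂ - 1) •
        (Iio (√t)).indicator (fun y : ℝ => y ^ (2 * n)) y) =
        (Iio (√t)).indicator (fun y : ℝ => y ^ (2 * n + 1)) := by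
      funext y
      simp only [indicator, Complex.finrank_real_complex]
      split_ifs <;> simp [pow_succ, mul_comm]
    rw [this, setIntegral_indicator measurableSet_Iio, Ioi_inter_Iio, ← integral_Ioc_eq_integral_Ioo,
      ← intervalIntegral.integral_of_le (Real.sqrt_nonneg t), integral_pow]
    have : √t ^ (2 * n + 1 + 1) = t ^ (n + 1) := by
      rw [show 2 * n + 1 + 1 = 2 * (n + 1) by ring, pow_mul, Real.sq_sqrt ht]
    rw [this]
    push_cast
    rw [zero_pow (by omega)]
    ring
  rw [e2, Measure.real, Complex.volume_ball]
  have : (n : ℝ) + 1 ≠ 0 := by positivity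
  simp
  have : (n : ℂ) + 1 ≠ 0 := by exact_mod_cast this
  field_simp

theorem setIntegral_disc_pow_mul_conj_pow (n m : ℕ) {t : ℝ} (h0 : 0 ≤ t) (h1 : t ≤ 1) :
    ∫ z in disc t, (z : ℂ) ^ n * conj (z : ℂ) ^ m ∂discMeasure =
      if n = m then (t : ℂ) ^ (n + 1) / (n + 1) else 0 := by
  rw [setIntegral_disc h1 fun z => z ^ n * conj z ^ m]
  split_ifs with h
  · subst h
    have : (Real.pi : ℂ) ≠ 0 := by exact_mod_cast Real.pi_ne_zero
    rw [setIntegral_pow_mul_conj_pow_self n h0]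
    field_simp
  · rw [setIntegral_pow_mul_conj_pow_of_ne h, mul_zero]

/-! ### Integrals of the kernel -/

theorem summable_succ_mul_pow {r : ℝ} (h0 : 0 ≤ r) (h1 : r < 1) :
    Summable fun n : ℕ => ((n : ℝ) + 1) * r ^ n := by
  have h := summable_pow_mul_geometric_of_norm_lt_one 1
    (by rwa [Real.norm_of_nonneg h0] : ‖r‖ < 1)
  simpa [add_mul] using h.add (summable_geometric_of_lt_one h0 h1)

variable (Λ : Set ℕ)

theorem norm_lt_one (z : Disc) : ‖(z : ℂ)‖ < 1 := mem_ball_zero_iff.1 z.2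

theorem norm_kernel_term (n : ℕ) (z w : ℂ) :
    ‖((n : ℂ) + 1) * z ^ n * conj w ^ n‖ = ((n : ℝ) + 1) * (‖z‖ * ‖w‖) ^ n := by
  have : ‖(n : ℂ) + 1‖ = (n : ℝ) + 1 := by exact_mod_cast Complex.norm_natCast (n + 1)
  rw [norm_mul, norm_mul, norm_pow, norm_pow, RCLike.norm_conj, this, mul_assoc, mul_pow]

theorem summable_kernel (z w : Disc) :
    Summable fun n : Λ => ‖((n : ℕ) + 1 : ℂ) * (z : ℂ) ^ (n : ℕ) * conj (w : ℂ) ^ (n : ℕ)‖ := by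
  simp only [norm_kernel_term]
  exact (summable_succ_mul_pow (by positivity)
    (mul_lt_one_of_nonneg_of_lt_one_left (norm_nonneg _) (norm_lt_one z) (norm_lt_one w).le)).subtype Λ

/-- The mean number of points in a disc. -/
theorem hasSum_setIntegral_diag {s : ℝ} (h0 : 0 ≤ s) (h1 : s < 1) :
    HasSum (fun n : Λ => (s : ℂ) ^ ((n : ℕ) + 1))
      (∫ z in disc s, subBergmanKernel Λ z z ∂discMeasure) := by
  have key : HasSum (fun n : Λ => ∫ z in disc s,
      ((n : ℕ) + 1 : ℂ) * (z : ℂ) ^ (n : ℕ) * conj (z : ℂ) ^ (n : ℕ) ∂discMeasure)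
      (∫ z in disc s, subBergmanKernel Λ z z ∂discMeasure) := by
    refine hasSum_integral_of_dominated_convergence
      (fun (n : Λ) _ => (((n : ℕ) : ℝ) + 1) * s ^ (n : ℕ)) (fun n => ?_) (fun n => ?_)
      (Filter.Eventually.of_forall fun z => (summable_succ_mul_pow h0 h1).subtype Λ)
      (integrable_const _)
      (Filter.Eventually.of_forall fun z => (summable_kernel Λ z z).of_norm.hasSum)
    · exact Continuous.aestronglyMeasurable (by fun_prop)
    · filter_upwards [ae_restrict_mem (measurableSet_disc s)] with z hz
      have hz : ‖(z : ℂ)‖ ^ 2 < s := hz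
      rw [norm_kernel_term, ← sq]
      gcongr
  refine key.congr_fun fun n => ?_
  have : ((n : ℕ) : ℂ) + 1 ≠ 0 := by exact_mod_cast Nat.succ_ne_zero n
  simp only [mul_assoc]
  rw [integral_const_mul, setIntegral_disc_pow_mul_conj_pow _ _ h0 h1.le, if_pos rfl]
  field_simp

/-- The integral of `|K_Λ|²` over a product of concentric discs: by orthogonality only the diagonal
terms of the double series survive. -/
theorem hasSum_setIntegral_prod {s t : ℝ} (hs0 : 0 ≤ s) (hs1 : s < 1) (ht0 : 0 ≤ t) (ht1 : t ≤ 1) :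
    HasSum (fun n : Λ => (s : ℂ) ^ ((n : ℕ) + 1) * (t : ℂ) ^ ((n : ℕ) + 1))
      (∫ z in disc s ×ˢ disc t, subBergmanKernel Λ z.1 z.2 * subBergmanKernel Λ z.2 z.1
        ∂(discMeasure.prod discMeasure)) := by
  have hr0 := Real.sqrt_nonneg s
  have hr1 : √s < 1 := by rwa [Real.sqrt_lt' one_pos, one_pow]
  have hsum : Summable fun n : Λ => (((n : ℕ) : ℝ) + 1) * √s ^ (n : ℕ) :=
    (summable_succ_mul_pow hr0 hr1).subtype Λ
  have hsum2 : Summable fun p : Λ × Λ => ((((p.1 : ℕ) : ℝ) + 1) * √s ^ (p.1 : ℕ)) *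
      ((((p.2 : ℕ) : ℝ) + 1) * √s ^ (p.2 : ℕ)) :=
    hsum.mul_of_nonneg hsum (fun n => show (0 : ℝ) ≤ _ by positivity)
      (fun n => show (0 : ℝ) ≤ _ by positivity)
  have key : HasSum (fun p : Λ × Λ => ∫ z in disc s ×ˢ disc t,
      (((p.1 : ℕ) + 1 : ℂ) * (z.1 : ℂ) ^ (p.1 : ℕ) * conj (z.2 : ℂ) ^ (p.1 : ℕ)) *
      (((p.2 : ℕ) + 1 : ℂ) * (z.2 : ℂ) ^ (p.2 : ℕ) * conj (z.1 : ℂ) ^ (p.2 : ℕ))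
        ∂(discMeasure.prod discMeasure))
      (∫ z in disc s ×ˢ disc t, subBergmanKernel Λ z.1 z.2 * subBergmanKernel Λ z.2 z.1
        ∂(discMeasure.prod discMeasure)) := by
    refine hasSum_integral_of_dominated_convergence
      (fun (p : Λ × Λ) _ => ((((p.1 : ℕ) : ℝ) + 1) * √s ^ (p.1 : ℕ)) *
        ((((p.2 : ℕ) : ℝ) + 1) * √s ^ (p.2 : ℕ))) (fun n => ?_) (fun n => ?_)
      (Filter.Eventually.of_forall fun z => hsum2)
      (integrable_const _) (Filter.Eventually.of_forall fun z => ?_)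
    · exact Continuous.aestronglyMeasurable (by fun_prop)
    · filter_upwards [ae_restrict_mem ((measurableSet_disc s).prod (measurableSet_disc t))]
        with z hz
      have hz1 : ‖(z.1 : ℂ)‖ ≤ √s := Real.le_sqrt_of_sq_le (le_of_lt hz.1)
      have hz2 := (norm_lt_one z.2).le
      rw [norm_mul, norm_kernel_term, norm_kernel_term]
      have h3 : ‖(z.1 : ℂ)‖ * ‖(z.2 : ℂ)‖ ≤ √s :=
        (mul_le_of_le_one_right (norm_nonneg _) hz2).trans hz1
      have h4 : ‖(z.2 : ℂ)‖ * ‖(z.1 : ℂ)‖ ≤ √s := by rwa [mul_comm]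
      gcongr
    · have h1 := summable_kernel Λ z.1 z.2
      have h2 := summable_kernel Λ z.2 z.1
      have h3 := (summable_mul_of_summable_norm h1 h2).hasSum
      rwa [← tsum_mul_tsum_of_summable_norm h1 h2] at h3
  have hint : ∀ p : Λ × Λ, ∫ z in disc s ×ˢ disc t,
      (((p.1 : ℕ) + 1 : ℂ) * (z.1 : ℂ) ^ (p.1 : ℕ) * conj (z.2 : ℂ) ^ (p.1 : ℕ)) *
      (((p.2 : ℕ) + 1 : ℂ) * (z.2 : ℂ) ^ (p.2 : ℕ) * conj (z.1 : ℂ) ^ (p.2 : ℕ))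
        ∂(discMeasure.prod discMeasure) =
      if p.1 = p.2 then (s : ℂ) ^ ((p.1 : ℕ) + 1) * (t : ℂ) ^ ((p.1 : ℕ) + 1) else 0 := by
    rintro ⟨n, m⟩
    have e : (fun z : Disc × Disc =>
        (((n : ℕ) + 1 : ℂ) * (z.1 : ℂ) ^ (n : ℕ) * conj (z.2 : ℂ) ^ (n : ℕ)) *
        (((m : ℕ) + 1 : ℂ) * (z.2 : ℂ) ^ (m : ℕ) * conj (z.1 : ℂ) ^ (m : ℕ))) = fun z =>
        (((n : ℕ) + 1 : ℂ) * ((m : ℕ) + 1)) *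
          (((z.1 : ℂ) ^ (n : ℕ) * conj (z.1 : ℂ) ^ (m : ℕ)) *
          ((z.2 : ℂ) ^ (m : ℕ) * conj (z.2 : ℂ) ^ (n : ℕ))) := by
      funext z
      ring
    have hn : ((n : ℕ) : ℂ) + 1 ≠ 0 := by exact_mod_cast Nat.succ_ne_zero n
    simp only [e]
    rw [integral_const_mul, setIntegral_prod_mul
      (fun z : Disc => (z : ℂ) ^ (n : ℕ) * conj (z : ℂ) ^ (m : ℕ))
      (fun z : Disc => (z : ℂ) ^ (m : ℕ) * conj (z : ℂ) ^ (n : ℕ)),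
      setIntegral_disc_pow_mul_conj_pow _ _ hs0 hs1.le,
      setIntegral_disc_pow_mul_conj_pow _ _ ht0 ht1]
    rcases eq_or_ne n m with rfl | h
    · simp only [if_true]
      field_simp
    · have h' : (n : ℕ) ≠ m := fun h2 => h (Subtype.ext h2)
      simp [h, h']
  simp only [hint] at key
  have hinj : Function.Injective fun n : Λ => (n, n) := fun a b h => (Prod.ext_iff.1 h).1
  have := (hinj.hasSum_iff (f := fun p : Λ × Λ =>
    if p.1 = p.2 then (s : ℂ) ^ ((p.1 : ℕ) + 1) * (t : ℂ) ^ ((p.1 : ℕ) + 1) else 0) ?_).2 key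
  · simpa [Function.comp_def] using this
  · rintro ⟨n, m⟩ h
    refine if_neg fun hnm => h ⟨n, ?_⟩
    exact Prod.ext rfl hnm

/-! ### The Bloch condition and the covariance estimate -/

/-- At a positive real point the Bloch condition bounds the power series of the derivative, whose
coefficients are non-negative. -/
theorem exists_tsum_le_of_isBloch (h : IsBloch (lambdaSeries Λ)) :
    ∃ C : ℝ, 0 ≤ C ∧ ∀ t : ℝ, 0 ≤ t → t < 1 →
      ∑' n : Λ, (((n : ℕ) : ℝ) + 1) * t ^ ((n : ℕ) + 1) ≤ C / (1 - t) := by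
  obtain ⟨C, hC⟩ := h.2
  have hC' : ∀ t : ℝ, 0 ≤ t → t < 1 → (1 - t) * ‖deriv (lambdaSeries Λ) t‖ ≤ C := by
    intro t h0 h1
    have := hC ⟨(t : ℂ), by simpa [abs_of_nonneg h0] using h1, rfl⟩
    simpa [abs_of_nonneg h0] using this
  have hC0 : 0 ≤ C := le_trans (by simp) (hC' 0 le_rfl one_pos)
  refine ⟨C + 1, by linarith, fun t h0 h1 => ?_⟩
  obtain ⟨r, htr, hr1⟩ := exists_between h1
  have hr0 : 0 ≤ r := h0.trans htr.le
  have hd := Complex.hasSum_deriv_of_summable_norm (F := fun (n : Λ) (z : ℂ) => z ^ (n : ℕ))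
    (u := fun n : Λ => r ^ (n : ℕ)) (U := Metric.ball 0 r) (z := (t : ℂ))
    ((summable_geometric_of_lt_one hr0 hr1).subtype Λ)
    (fun n => (differentiable_pow _).differentiableOn) Metric.isOpen_ball
    (fun n w hw => by
      rw [norm_pow]
      exact pow_le_pow_left₀ (norm_nonneg _) (mem_ball_zero_iff.1 hw).le _)
    (by simpa [abs_of_nonneg h0] using htr)
  change HasSum _ (deriv (lambdaSeries Λ) t) at hd
  have hd' : HasSum (fun n : Λ => ((n : ℕ) : ℝ) * t ^ ((n : ℕ) - 1))
      (deriv (lambdaSeries Λ) t).re := by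
    refine (Complex.hasSum_re hd).congr_fun fun n => ?_
    rw [deriv_pow_field]
    norm_cast
  have hg : Summable fun n : Λ => t ^ (n : ℕ) := (summable_geometric_of_lt_one h0 h1).subtype Λ
  have hle : ∀ n : Λ, (((n : ℕ) : ℝ) + 1) * t ^ ((n : ℕ) + 1) ≤
      ((n : ℕ) : ℝ) * t ^ ((n : ℕ) - 1) + t ^ (n : ℕ) := by
    intro n
    rw [add_mul, one_mul]
    have h2 : ∀ {a b : ℕ}, a ≤ b → t ^ b ≤ t ^ a := fun h => pow_le_pow_of_le_one h0 h1.le h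
    exact add_le_add (mul_le_mul_of_nonneg_left (h2 (by omega)) (Nat.cast_nonneg _))
      (h2 (by omega))
  have hs : Summable fun n : Λ => (((n : ℕ) : ℝ) + 1) * t ^ ((n : ℕ) + 1) :=
    Summable.of_nonneg_of_le (fun n => by positivity) hle (hd'.summable.add hg)
  have hg1 : ∑' n : Λ, t ^ (n : ℕ) ≤ (1 - t)⁻¹ := by
    rw [← tsum_geometric_of_lt_one h0 h1]
    exact Summable.tsum_subtype_le _ Λ (fun n => by positivity)
      (summable_geometric_of_lt_one h0 h1)
  have hpos : 0 < 1 - t := by linarith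
  calc _ ≤ (deriv (lambdaSeries Λ) t).re + ∑' n : Λ, t ^ (n : ℕ) := by
        rw [← hd'.tsum_eq, ← hd'.summable.tsum_add hg]
        exact hs.tsum_le_tsum hle (hd'.summable.add hg)
    _ ≤ C / (1 - t) + (1 - t)⁻¹ := by
        refine add_le_add ?_ hg1
        rw [le_div_iff₀' hpos]
        exact (mul_le_mul_of_nonneg_left (Complex.re_le_norm _) hpos.le).trans (hC' t h0 h1)
    _ = (C + 1) / (1 - t) := by rw [add_div, one_div]

open PointProcess in
/-- The covariance of the counts in two concentric discs of squared radii `s ≤ t` is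
`∑ s ^ (n + 1) (1 - t ^ (n + 1)) ≤ (1 - t) ∑ (n + 1) s ^ (n + 1)`, and the Bloch condition bounds
the last series by a multiple of `1 / (1 - s)`. -/
theorem disc_covariance_le (h : IsBloch (lambdaSeries Λ)) :
    ∃ C : ℝ, 0 ≤ C ∧ ∀ (P : Measure (Configuration Disc)) [IsProbabilityMeasure P],
      IsDeterminantal discMeasure (subBergmanKernel Λ) P → ∀ s t : ℝ, 0 ≤ s → s ≤ t → t < 1 →
      ∫ X, ((X.count (disc s) : ℝ) - ∫ Y, (Y.count (disc s) : ℝ) ∂P) *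
        (X.count (disc t) - ∫ Y, (Y.count (disc t) : ℝ) ∂P) ∂P ≤ C * ((1 - t) / (1 - s)) := by
  obtain ⟨C, hC0, hC⟩ := exists_tsum_le_of_isBloch Λ h
  refine ⟨C, hC0, fun P _ hP s t hs hst ht => ?_⟩
  have hs1 := hst.trans_lt ht
  have ht0 := hs.trans hst
  obtain ⟨-, e⟩ := hP.nested_covariance (isBoundedBorel_disc hs1) (isBoundedBorel_disc ht)
    (disc_subset_disc hst)
  have hsum := (hasSum_setIntegral_diag Λ hs hs1).sub (hasSum_setIntegral_prod Λ hs hs1 ht0 ht.le)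
  rw [← e] at hsum
  have hsum' : HasSum (fun n : Λ => s ^ ((n : ℕ) + 1) * (1 - t ^ ((n : ℕ) + 1)))
      (∫ X, ((X.count (disc s) : ℝ) - ∫ Y, (Y.count (disc s) : ℝ) ∂P) *
        (X.count (disc t) - ∫ Y, (Y.count (disc t) : ℝ) ∂P) ∂P) := by
    rw [← Complex.hasSum_ofReal]
    refine hsum.congr_fun fun n => ?_
    push_cast
    ring
  have hb : Summable fun n : Λ => (((n : ℕ) : ℝ) + 1) * s ^ ((n : ℕ) + 1) := by
    have := ((summable_succ_mul_pow hs hs1).subtype Λ).mul_right s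
    refine this.congr fun n => ?_
    simp only [Function.comp, pow_succ]
    ring
  have hle : ∀ n : Λ, s ^ ((n : ℕ) + 1) * (1 - t ^ ((n : ℕ) + 1)) ≤
      (1 - t) * ((((n : ℕ) : ℝ) + 1) * s ^ ((n : ℕ) + 1)) := by
    intro n
    -- Bernoulli's inequality
    have h1 := one_add_mul_le_pow (a := t - 1) (by linarith) ((n : ℕ) + 1)
    rw [add_sub_cancel] at h1
    push_cast at h1
    have h2 : 1 - t ^ ((n : ℕ) + 1) ≤ (1 - t) * (((n : ℕ) : ℝ) + 1) := by linarith
    calc _ ≤ s ^ ((n : ℕ) + 1) * ((1 - t) * (((n : ℕ) : ℝ) + 1)) := by gcongr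
      _ = _ := by ring
  rw [← hsum'.tsum_eq]
  calc _ ≤ ∑' n : Λ, (1 - t) * ((((n : ℕ) : ℝ) + 1) * s ^ ((n : ℕ) + 1)) :=
        hsum'.summable.tsum_le_tsum hle (hb.mul_left _)
    _ = (1 - t) * ∑' n : Λ, (((n : ℕ) : ℝ) + 1) * s ^ ((n : ℕ) + 1) := tsum_mul_left
    _ ≤ (1 - t) * (C / (1 - s)) := mul_le_mul_of_nonneg_left (hC s hs hs1) (by linarith)
    _ = C * ((1 - t) / (1 - s)) := by ring

end SubBergman

open PointProcess SubBergman in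
theorem theorem1p1 (Λ : Set ℕ) (hΛ : Λ.Infinite)
    (hBloch : SubBergman.IsBloch (SubBergman.lambdaSeries Λ))
    (P : MeasureTheory.Measure (PointProcess.Configuration SubBergman.Disc))
    [MeasureTheory.IsProbabilityMeasure P]
    (hP : PointProcess.IsDeterminantal SubBergman.discMeasure (SubBergman.subBergmanKernel Λ) P) :
    PointProcess.IsNumberRigid P := by
  obtain ⟨C, hC0, hC⟩ := disc_covariance_le Λ hBloch
  refine isNumberRigid_of_covariance_le fun B hB => ?_
  obtain ⟨t, ht, hBt⟩ := exists_subset_disc hB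
  obtain ⟨j₀, hj₀⟩ := exists_pow_lt_of_lt_one (sub_pos.2 ht) (by norm_num : (1 / 2 : ℝ) < 1)
  -- Squared radii with `1 - r j` halving at each step turn `(1 - r k) / (1 - r j)` into
  -- `2 ^ (j - k)`; the shift `j₀` makes all the discs contain `B`.
  let r : ℕ → ℝ := fun j => 1 - (1 / 2) ^ (j + j₀)
  have hr1 : ∀ j, r j < 1 := fun j => sub_lt_self _ (by positivity)
  have hr0 : ∀ j, 0 ≤ r j := fun j => sub_nonneg.2 (pow_le_one₀ (by norm_num) (by norm_num))
  have hmono : Monotone r := fun j k hjk =>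
    sub_le_sub_left (pow_le_pow_of_le_one (by norm_num) (by norm_num) (by omega)) _
  have hb : ∀ j, IsBoundedBorel (disc (r j)) := fun j => isBoundedBorel_disc (hr1 j)
  have hi := fun j k (hjk : j ≤ k) =>
    (hP.nested_covariance (hb j) (hb k) (disc_subset_disc (hmono hjk))).1
  refine ⟨fun j => disc (r j), fun j => ∫ Y, (Y.count (disc (r j)) : ℝ) ∂P, C, hC0,
    fun j => ⟨hb j, hBt.trans (disc_subset_disc ?_)⟩, fun j k => ?_, fun j k hjk => ?_⟩
  · have : r 0 ≤ r j := hmono (Nat.zero_le j)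
    simp only [r, zero_add] at this ⊢
    linarith
  · rcases le_total j k with hjk | hjk
    · exact hi j k hjk
    · exact (hi k j hjk).congr (Filter.Eventually.of_forall fun X => mul_comm _ _)
  · refine (hC P hP _ _ (hr0 j) (hmono hjk) (hr1 k)).trans (le_of_eq ?_)
    obtain ⟨d, rfl⟩ := Nat.exists_eq_add_of_le hjk
    simp only [r, sub_sub_cancel, Nat.add_sub_cancel_left]
    rw [show j + d + j₀ = d + (j + j₀) by ring, pow_add, mul_div_assoc,
      div_self (by positivity), mul_one]
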